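/- Let $\mathcal{Y}$ be a real separable Hilbert space, $\mathcal{X}$ a set, $x_1,\dots,x_n\in\mathcal{X}$ fixed design points, $\mathcal{G}$ a class of functions $\mathcal{X}\to\mathcal{Y}$ and $g_0\in\mathcal{G}$. For $g:\mathcal{X}\to\mathcal{Y}$ write $\lVert g\rVert_{2,P_n}=\big(\frac1n\sum_{i=1}^n\lVert g(x_i)\rVert_{\mathcal{Y}}^2\big)^{1/2}$. We observe $$Y_i=g_0(x_i)+\varepsilon_i,\qquad i=1,\dots,n,$$ where $\varepsilon_1,\dots,\varepsilon_n$ are i.i.d. Gaussian random variables in $\mathcal{Y}$ (that is, $\langle\varepsilon_i,y\rangle$ is real Gaussian, possibly degenerate, for every $y\in\mathcal{Y}$) with mean $0$ and covariance operator $Q$ such that $\operatorname{Tr}Q=1$. Assume that the least-squares estimator $$\hat g_n\in\operatorname*{arg\,min}_{g\in\mathcal{G}}\frac1n\sum_{i=1}^n\lVert Y_i-g(x_i)\rVert_{\mathcal{Y}}^2$$ exists almost surely. Let $\mathcal{F}$ be a class of functions $\mathcal{X}\to\mathcal{Y}$ that contains $g-g_0$ for every $g\in\mathcal{G}$ (for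 example $\mathcal{F}=\{g-g_0:g\in\mathcal{G}\}$, or $\mathcal{F}=\mathcal{G}$ if $\mathcal{G}$ is closed under subtraction of $g_0$), let $\mathcal{B}(\delta)=\{h\in\mathcal{F}:\lVert h\rVert_{2,P_n}\le\delta\}$, and let $H(u,\mathcal{B}(\delta))=\log N(u,\mathcal{B}(\delta))$, where $N(u,\mathcal{B}(\delta))$ is the minimal number of closed $\lVert\cdot\rVert_{2,P_n}$-balls of radius $u$ with centres in $\mathcal{B}(\delta)$ that cover $\mathcal{B}(\delta)$ (and $\infty$ if there is no finite covering). Suppose that $$J(\delta):=4\int_0^\delta\sqrt{2H(u,\mathcal{B}(\delta))}\,du<\infty\quad\text{for every }\delta>0,$$ and that $\delta\mapsto J(\delta)/\delta^2$ is non-increasing on $(0,\infty)$. Then for all $t\ge\frac38$ and all $\delta_n>0$ satisfying $$\sqrt n\,\delta_n^2\ge8\left(J(\delta_n)+4\delta_n\sqrt{1+t}+\delta_n\sqrt{\tfrac83t}\right),$$ we have $$\mathbb{P}\left(\lVert\hat g_n-g_0\rVert_{2,P_n}>\delta_n\right)\le\left(1+\frac{2}{e-1}\right)e^{-t},$$ where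 $\mathbb{P}$ denotes outer probability if the event is not measurable. -/

import Mathlib

open MeasureTheory ProbabilityTheory
open scoped ENNReal NNReal RealInnerProductSpace

noncomputable section

namespace LeastSquares

variable {n : ℕ} {X Y : Type*} [NormedAddCommGroup Y]

/-- The empirical seminorm `‖g‖_{2,Pₙ} = ((1/n) ∑ᵢ ‖g(xᵢ)‖²)^{1/2}`, where
`Pₙ = (1/n) ∑ᵢ δ_{xᵢ}` is the empirical measure of the design points `x₁, …, xₙ`. -/
def empNorm (x : Fin n → X) (g : X → Y) : ℝ :=
  Real.sqrt ((n : ℝ)⁻¹ * ∑ i, ‖g (x i)‖ ^ 2)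

theorem empNorm_eq (x : Fin n → X) (g : X → Y) :
    empNorm x g = Real.sqrt (n : ℝ)⁻¹ * ‖WithLp.toLp 2 (fun i => g (x i))‖ := by
  rw [empNorm, PiLp.norm_eq_of_L2, Real.sqrt_mul (by positivity)]

/-- The pseudometric `(g, h) ↦ ‖g - h‖_{2,Pₙ}` on functions `X → Y`. -/
@[reducible]
def empPseudoMetric (x : Fin n → X) : PseudoMetricSpace (X → Y) where
  dist g h := empNorm x (g - h)
  dist_self g := by simp [empNorm]
  dist_comm g h := by simp [empNorm, norm_sub_rev]
  dist_triangle f g h := by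
    simp only [empNorm_eq]
    rw [← mul_add]
    refine mul_le_mul_of_nonneg_left ?_ (Real.sqrt_nonneg _)
    refine le_trans (le_of_eq ?_) (norm_add_le _ _)
    congr 1
    ext i
    simp

/-- The covering number `N(u, B, ‖·‖_{2,Pₙ})`: the least number of closed balls of radius `u` with
centres in `B` that cover `B` (`⊤` if there is no finite covering). -/
def covNum (x : Fin n → X) (u : ℝ) (B : Set (X → Y)) : ℕ∞ :=
  @Metric.coveringNumber (X → Y) (empPseudoMetric x).toPseudoEMetricSpace u.toNNReal B

/-- The entropy `H(u, B, ‖·‖_{2,Pₙ}) = log N(u, B, ‖·‖_{2,Pₙ})`, with values in `[0, ∞]`. -/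
def entropy (x : Fin n → X) (u : ℝ) (B : Set (X → Y)) : ℝ≥0∞ :=
  (ENNReal.log (covNum x u B : ℝ≥0∞)).toENNReal

/-- The local class `{h ∈ F : ‖h‖_{2,Pₙ} ≤ δ}`. -/
def localClass (x : Fin n → X) (F : Set (X → Y)) (δ : ℝ) : Set (X → Y) :=
  {h | h ∈ F ∧ empNorm x h ≤ δ}

/-- The local entropy integral `J(δ) = 4 ∫₀^δ √(2 H(u, {h ∈ F : ‖h‖ ≤ δ}, ‖·‖)) du` with
`‖·‖ = ‖·‖_{2,Pₙ}`, as an element of `[0, ∞]`. -/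
def entropyIntegral (x : Fin n → X) (F : Set (X → Y)) (δ : ℝ) : ℝ≥0∞ :=
  4 * ∫⁻ u in Set.Ioc 0 δ, (2 * entropy x u (localClass x F δ)) ^ (1 / 2 : ℝ)

/-- The continuous linear operator `Q` has trace `τ`: for every orthonormal basis `(e_j)` of `Y`,
`∑_j ⟨Q e_j, e_j⟩` converges to `τ`. Every orthonormal basis is, up to relabelling, indexed by a
subset of `Y`. -/
def HasTrace [InnerProductSpace ℝ Y] (Q : Y →L[ℝ] Y) (τ : ℝ) : Prop :=
  ∀ (s : Set Y) (e : HilbertBasis s ℝ Y), HasSum (fun j => ⟪Q (e j), e j⟫) τ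

/-- `ghat` is a least-squares fit over the class `G` to the data `(x₁, y₁), …, (xₙ, yₙ)`: a member
of `G` that minimises `(1/n) ∑ᵢ ‖yᵢ - g(xᵢ)‖²` over `g ∈ G`. -/
def IsLeastSquaresFit (x : Fin n → X) (G : Set (X → Y)) (y : Fin n → Y) (ghat : X → Y) : Prop :=
  ghat ∈ G ∧ IsMinOn (fun g : X → Y => (n : ℝ)⁻¹ * ∑ i, ‖y i - g (x i)‖ ^ 2) G ghat

end LeastSquares

end

namespace LeastSquares

/-! Comparing the least-squares fit with `g₀` gives the basic inequality √n‖ĝ - g₀‖² ≤ 2 W(ĝ - g₀),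
where W is the noise process. As Tr Q = 1 dominates every ⟨Qu, u⟩ with ‖u‖ = 1, W(h) is sub-Gaussian
with variance proxy ‖h‖². Chaining along dyadic covers of the ball of radius R bounds W there by
J(R) + 4R√(1+t), outside a set of measure at most e^{-t} (`exists_noiseProcess_le`).

The error event is then peeled into shells 2^s δ ≤ ‖ĝ - g₀‖ < 2^{s+1} δ. On shell s the maximal
bound is used with R = 2^{s+1} δ and t replaced by 4^{s+1} t. Since J(δ)/δ² is non-increasing, the
critical inequality survives this scaling (`critical_inequality_dyadic`) and contradicts the basic
inequality off the exceptional set. The exceptional probabilities sum to at most e^{-t}. Every event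
is only enclosed in a set of small outer measure, so no supremum needs to be measurable. -/

theorem HasTrace.inner_apply_self_le {Y : Type*} [NormedAddCommGroup Y] [InnerProductSpace ℝ Y]
    [CompleteSpace Y] {Q : Y →L[ℝ] Y} {τ : ℝ} (hQ : HasTrace Q τ) (hpos : ∀ y, 0 ≤ ⟪Q y, y⟫)
    (y : Y) : ⟪Q y, y⟫ ≤ τ * ‖y‖ ^ 2 := by
  rcases eq_or_ne y 0 with rfl | hy
  · simp
  have hy' : ‖y‖ ≠ 0 := norm_ne_zero_iff.2 hy
  set u : Y := ‖y‖⁻¹ • y with hu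
  have hu1 : ‖u‖ = 1 := by rw [hu, norm_smul, norm_inv, norm_norm, inv_mul_cancel₀ hy']
  have hon : Orthonormal ℝ ((↑) : ({u} : Set Y) → Y) := by
    refine ⟨fun i => ?_, fun i j hij => absurd (Subsingleton.elim i j) hij⟩
    obtain ⟨i, rfl⟩ := i
    exact hu1
  -- With u as a basis vector, ⟨Qu, u⟩ is one term of a nonnegative series summing to the trace.
  obtain ⟨s, b, hs, hb⟩ := hon.exists_hilbertBasis_extension
  have hle : ⟪Q u, u⟫ ≤ τ := by
    have h := le_hasSum (hQ s b) ⟨u, hs rfl⟩ (fun j _ => hpos _)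
    simpa [hb] using h
  have hyu : y = ‖y‖ • u := by rw [hu, smul_smul, mul_inv_cancel₀ hy', one_smul]
  calc ⟪Q y, y⟫ = ‖y‖ ^ 2 * ⟪Q u, u⟫ := by
        rw [hyu, map_smul, real_inner_smul_left, real_inner_smul_right, norm_smul, hu1, norm_norm]
        ring
    _ ≤ τ * ‖y‖ ^ 2 := by nlinarith [sq_nonneg ‖y‖]

theorem _root_.ProbabilityTheory.HasSubgaussianMGF.mono {Ω : Type*} [MeasurableSpace Ω]
    {P : Measure Ω} {Z : Ω → ℝ} {c d : ℝ≥0} (h : HasSubgaussianMGF Z c P) (hcd : c ≤ d) :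
    HasSubgaussianMGF Z d P where
  integrable_exp_mul := h.integrable_exp_mul
  mgf_le s := (h.mgf_le s).trans (by gcongr)

/-- The noise process `n^{-1/2} ∑ᵢ ⟨eᵢ, h(xᵢ)⟩`. -/
noncomputable def noiseProcess {n : ℕ} {X Y : Type*} [NormedAddCommGroup Y] [InnerProductSpace ℝ Y]
    (x : Fin n → X) (e : Fin n → Y) (h : X → Y) : ℝ :=
  (Real.sqrt n)⁻¹ * ∑ i, ⟪e i, h (x i)⟫

/-! ### Noise process and basic inequality -/

section NoiseBounds

variable {n : ℕ} {X Y : Type*} [NormedAddCommGroup Y]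

theorem empNorm_sq (x : Fin n → X) (g : X → Y) :
    empNorm x g ^ 2 = (n : ℝ)⁻¹ * ∑ i, ‖g (x i)‖ ^ 2 :=
  Real.sq_sqrt (by positivity)

theorem empNorm_nonneg (x : Fin n → X) (g : X → Y) : 0 ≤ empNorm x g := Real.sqrt_nonneg _

variable [InnerProductSpace ℝ Y]

theorem noiseProcess_sub (x : Fin n → X) (e : Fin n → Y) (g h : X → Y) :
    noiseProcess x e (g - h) = noiseProcess x e g - noiseProcess x e h := by
  simp [noiseProcess, inner_sub_right, Finset.sum_sub_distrib, mul_sub]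

theorem noiseProcess_zero (x : Fin n → X) (e : Fin n → Y) :
    noiseProcess x e 0 = 0 := by
  simp [noiseProcess]

/-- Cauchy–Schwarz. The factor depends on the noise alone, so for a fixed outcome the chaining
remainder vanishes with the radius. -/
theorem noiseProcess_le (x : Fin n → X) (e : Fin n → Y) (h : X → Y) :
    noiseProcess x e h ≤ Real.sqrt (∑ i, ‖e i‖ ^ 2) * empNorm x h := by
  have h1 : ∑ i, ⟪e i, h (x i)⟫ ≤ Real.sqrt (∑ i, ‖e i‖ ^ 2) * Real.sqrt (∑ i, ‖h (x i)‖ ^ 2) :=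
    (Finset.sum_le_sum fun i _ => real_inner_le_norm _ _).trans
      (Real.sum_mul_le_sqrt_mul_sqrt _ _ _)
  calc noiseProcess x e h
      ≤ (Real.sqrt n)⁻¹ *
          (Real.sqrt (∑ i, ‖e i‖ ^ 2) * Real.sqrt (∑ i, ‖h (x i)‖ ^ 2)) := by
        unfold noiseProcess; gcongr
    _ = Real.sqrt (∑ i, ‖e i‖ ^ 2) * empNorm x h := by
        rw [empNorm, Real.sqrt_mul (by positivity), Real.sqrt_inv]; ring

/-- The basic inequality for least squares. -/
theorem IsLeastSquaresFit.sqrt_mul_empNorm_sq_le {x : Fin n → X} {G : Set (X → Y)}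
    {g₀ ghat : X → Y} (hg₀ : g₀ ∈ G) {y e : Fin n → Y} (hy : ∀ i, y i = g₀ (x i) + e i)
    (hfit : IsLeastSquaresFit x G y ghat) :
    Real.sqrt n * empNorm x (ghat - g₀) ^ 2 ≤ 2 * noiseProcess x e (ghat - g₀) := by
  rcases Nat.eq_zero_or_pos n with rfl | hn
  · simp [noiseProcess]
  have hn' : (0 : ℝ) < n := Nat.cast_pos.2 hn
  have h1 := isMinOn_iff.1 hfit.2 g₀ hg₀
  have h2 : ∑ i, ‖y i - ghat (x i)‖ ^ 2 ≤ ∑ i, ‖y i - g₀ (x i)‖ ^ 2 :=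
    le_of_mul_le_mul_left h1 (inv_pos.2 hn')
  have h3 : ∑ i, ‖(ghat - g₀) (x i)‖ ^ 2 ≤ 2 * ∑ i, ⟪e i, (ghat - g₀) (x i)⟫ := by
    rw [Finset.mul_sum, ← sub_nonneg, ← Finset.sum_sub_distrib]
    rw [← sub_nonneg, ← Finset.sum_sub_distrib] at h2
    refine h2.trans_eq (Finset.sum_congr rfl fun i _ => ?_)
    have e1 : y i - g₀ (x i) = e i := by rw [hy]; abel
    have e2 : y i - ghat (x i) = e i - (ghat - g₀) (x i) := by rw [hy, Pi.sub_apply]; abel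
    rw [e1, e2, norm_sub_sq_real]
    ring
  have hs : Real.sqrt n * (n : ℝ)⁻¹ = (Real.sqrt n)⁻¹ := by
    have : Real.sqrt n ≠ 0 := (Real.sqrt_pos.2 hn').ne'
    field_simp
    exact Real.sq_sqrt hn'.le
  rw [empNorm_sq, ← mul_assoc, hs, noiseProcess, mul_left_comm]
  gcongr

end NoiseBounds

/-! ### Sub-Gaussian tails of the noise -/

section Tail

variable {Ω : Type*} [MeasurableSpace Ω] {P : Measure Ω} [IsProbabilityMeasure P]
  {X Y : Type*} [NormedAddCommGroup Y] [InnerProductSpace ℝ Y] [CompleteSpace Y]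
  [TopologicalSpace.SeparableSpace Y] [MeasurableSpace Y] [BorelSpace Y]
  {μ : Measure Y}

omit [IsProbabilityMeasure P] in
theorem hasSubgaussianMGF_inner [IsGaussian μ] (hmean : ∫ y, y ∂μ = 0)
    (htrace : HasTrace (covarianceOperator μ) 1) {ξ : Ω → Y} (hξ : HasLaw ξ μ P) (y : Y) :
    HasSubgaussianMGF (fun ω => ⟪ξ ω, y⟫) (‖y‖₊ ^ 2) P := by
  have : SecondCountableTopology Y := UniformSpace.secondCountable_of_separable Y
  have hmem : MemLp id 2 μ := IsGaussian.memLp_two_id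
  have hm : μ[innerSL ℝ y] = 0 := by
    rw [IsGaussian.integral_dual, hmean, map_zero]
  have hvar : Var[innerSL ℝ y; μ] ≤ ‖y‖ ^ 2 := by
    rw [variance_of_integral_eq_zero (by fun_prop) hm]
    have h1 := htrace.inner_apply_self_le (fun z => ?_) y
    · rw [covarianceOperator_inner hmem, one_mul] at h1
      simpa [pow_two] using h1
    · rw [covarianceOperator_inner hmem]
      exact integral_nonneg fun w => mul_self_nonneg _
  have hmap : μ.map (innerSL ℝ y) = gaussianReal 0 (Var[innerSL ℝ y; μ]).toNNReal := by
    rw [IsGaussian.map_eq_gaussianReal, hm]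
  have hsub : HasSubgaussianMGF (innerSL ℝ y) (Var[innerSL ℝ y; μ]).toNNReal μ := by
    rw [← HasSubgaussianMGF.id_map_iff (by fun_prop), hmap]
    refine ⟨integrable_exp_mul_gaussianReal, fun s => ?_⟩
    rw [mgf_id_gaussianReal]
    simp
  have hsub' : HasSubgaussianMGF (innerSL ℝ y) (‖y‖₊ ^ 2) μ :=
    hsub.mono (Real.toNNReal_le_iff_le_coe.2 (by simpa using hvar))
  have h2 := HasSubgaussianMGF.of_map hξ.aemeasurable (hξ.map_eq.symm ▸ hsub')
  refine h2.congr (ae_of_all _ fun ω => ?_)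
  simp [real_inner_comm]

/-- By independence the proxies ‖h(xᵢ)‖² add up, and the factor 1/n turns the sum into ‖h‖² ≤ r²;
the Chernoff bound follows. -/
theorem measure_le_noiseProcess_le [IsGaussian μ] (hmean : ∫ y, y ∂μ = 0)
    (htrace : HasTrace (covarianceOperator μ) 1) {n : ℕ} {ε : Fin n → Ω → Y}
    (hlaw : ∀ i, HasLaw (ε i) μ P) (hindep : iIndepFun ε P) (x : Fin n → X) {h : X → Y} {r a : ℝ}
    (hr : empNorm x h ≤ r) (ha : 0 ≤ a) :
    P {ω | a ≤ noiseProcess x (fun i => ε i ω) h}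
      ≤ ENNReal.ofReal (Real.exp (-a ^ 2 / (2 * r ^ 2))) := by
  have hind : iIndepFun (fun i ω => ⟪ε i ω, h (x i)⟫) P :=
    hindep.comp (fun i y => ⟪y, h (x i)⟫) fun i => by fun_prop
  have hsum := HasSubgaussianMGF.sum_of_iIndepFun hind (s := Finset.univ)
    fun i _ => hasSubgaussianMGF_inner hmean htrace (hlaw i) (h (x i))
  have hW := (hsum.const_mul (Real.sqrt n)⁻¹).mono (d := r.toNNReal ^ 2) (by
    rw [← NNReal.coe_le_coe]
    have hr0 : 0 ≤ r := (empNorm_nonneg x h).trans hr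
    have h1 : empNorm x h ^ 2 ≤ r ^ 2 := pow_le_pow_left₀ (empNorm_nonneg x h) hr 2
    rw [empNorm_sq] at h1
    push_cast
    rw [Real.coe_toNNReal r hr0]
    have h2 : (Real.sqrt n)⁻¹ ^ 2 = (n : ℝ)⁻¹ := by rw [inv_pow, Real.sq_sqrt (Nat.cast_nonneg n)]
    refine Eq.trans_le ?_ h1
    refine (NNReal.coe_mul _ _).trans ?_
    refine congrArg₂ (· * ·) h2 ?_
    simp)
  have ht := hW.measure_ge_le ha
  rw [← ofReal_measureReal]
  refine ENNReal.ofReal_le_ofReal (ht.trans_eq ?_)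
  push_cast
  rw [Real.coe_toNNReal r ((empNorm_nonneg x h).trans hr)]

end Tail

/-! ### Covers and the dyadic entropy sum -/

section Entropy

variable {n : ℕ} {X Y : Type*} [NormedAddCommGroup Y]

theorem entropy_antitone (x : Fin n → X) (B : Set (X → Y)) :
    Antitone fun u => entropy x u B := by
  intro u v huv
  refine EReal.toENNReal_le_toENNReal (ENNReal.log_monotone ?_)
  let _ := empPseudoMetric (Y := Y) x
  exact_mod_cast Metric.coveringNumber_anti (A := B) (Real.toNNReal_le_toNNReal huv)

/-- Nonemptiness matters for the cardinality: an empty cover would have entropy truncated to 0,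
hence exponential 1 rather than 0. -/
theorem exists_finset_cover (x : Fin n → X) {B : Set (X → Y)} (hB : B.Nonempty) {u : ℝ}
    (hu : 0 ≤ u) (hH : entropy x u B ≠ ∞) :
    ∃ C : Finset (X → Y), ↑C ⊆ B ∧ (∀ h ∈ B, ∃ p ∈ C, empNorm x (h - p) ≤ u) ∧
      (C.card : ℝ) = Real.exp (entropy x u B).toReal := by
  let _ := empPseudoMetric (Y := Y) x
  have hN : covNum x u B ≠ ⊤ := by
    intro h
    apply hH
    simp [entropy, h]
  obtain ⟨C, hCB, hCfin, hcov, hcard⟩ := Metric.exists_set_encard_eq_coveringNumber hN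
  lift C to Finset (X → Y) using hCfin
  refine ⟨C, hCB, fun h hh => ?_, ?_⟩
  · obtain ⟨p, hp, hd⟩ := hcov hh
    refine ⟨p, hp, ?_⟩
    have hd' : edist h p ≤ ENNReal.ofReal u := hd
    exact (edist_le_ofReal hu).1 hd'
  · have hne : C.Nonempty := by
      obtain ⟨h, hh⟩ := hB
      obtain ⟨p, hp, -⟩ := hcov hh
      exact ⟨p, hp⟩
    have h1 : (1 : ℝ) ≤ C.card := by exact_mod_cast hne.card_pos
    have hc : covNum x u B = (C.card : ℕ∞) := by
      rw [← Set.encard_coe_eq_coe_finsetCard]; exact hcard.symm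
    have : entropy x u B = ENNReal.ofReal (Real.log C.card) := by
      rw [entropy, hc]
      have h2 : (((C.card : ℕ∞) : ℝ≥0∞)) = ENNReal.ofReal (C.card : ℝ) := by simp
      rw [h2, ENNReal.log_ofReal_of_pos (by linarith)]
      simp
    rw [this, ENNReal.toReal_ofReal (Real.log_nonneg h1), Real.exp_log (by linarith)]

/-- The dyadic entropy sum is bounded by the entropy integral. -/
theorem sum_dyadic_entropy_le_entropyIntegral (x : Fin n → X) (F : Set (X → Y)) {R : ℝ}
    (hR : 0 < R) (K : ℕ) :
    ∑ k ∈ Finset.range K, ENNReal.ofReal (R / 2 ^ k) *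
        (2 * entropy x (R / 2 ^ (k + 1)) (localClass x F R)) ^ (1 / 2 : ℝ)
      ≤ entropyIntegral x F R := by
  set f : ℝ → ℝ≥0∞ := fun u => (2 * entropy x u (localClass x F R)) ^ (1 / 2 : ℝ) with hf
  have hanti : Antitone f := fun u v huv =>
    ENNReal.rpow_le_rpow (by gcongr; exact entropy_antitone x _ huv) (by norm_num)
  have hle : ∀ k l : ℕ, k ≤ l → R / 2 ^ l ≤ R / 2 ^ k := fun k l hkl => by
    gcongr
    norm_num
  have hterm : ∀ k : ℕ, ENNReal.ofReal (R / 2 ^ k) * f (R / 2 ^ (k + 1))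
      ≤ 4 * ∫⁻ u in Set.Ioc (R / 2 ^ (k + 2)) (R / 2 ^ (k + 1)), f u := by
    intro k
    -- The 4 in J arises here: R/2^k is four times the length of (R/2^{k+2}, R/2^{k+1}], where the
    -- antitone integrand is least at the right endpoint.
    have h4 : ENNReal.ofReal (R / 2 ^ k)
        = 4 * ENNReal.ofReal (R / 2 ^ (k + 1) - R / 2 ^ (k + 2)) := by
      rw [show (4 : ℝ≥0∞) = ENNReal.ofReal 4 by simp, ← ENNReal.ofReal_mul (by norm_num)]
      congr 1
      rw [pow_add, pow_add]
      field_simp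
      norm_num
    rw [h4, mul_assoc]
    gcongr
    rw [mul_comm, ← Real.volume_Ioc, ← setLIntegral_const]
    exact setLIntegral_mono' measurableSet_Ioc fun u hu => hanti hu.2
  have hsum : ∀ K : ℕ, ∑ k ∈ Finset.range K, ENNReal.ofReal (R / 2 ^ k) * f (R / 2 ^ (k + 1))
      ≤ 4 * ∫⁻ u in Set.Ioc (R / 2 ^ (K + 1)) R, f u := by
    intro K
    induction K with
    | zero => simp
    | succ K ih =>
      rw [Finset.sum_range_succ]
      refine (add_le_add ih (hterm K)).trans_eq ?_
      rw [← mul_add, add_comm, ← lintegral_union measurableSet_Ioc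
        (Set.Ioc_disjoint_Ioc_of_le le_rfl), Set.Ioc_union_Ioc_eq_Ioc (hle _ _ (by lia))]
      simpa using hle 0 (K + 1) (by lia)
  refine (hsum K).trans ?_
  unfold entropyIntegral
  gcongr
  positivity

end Entropy

theorem sqrt_add_le_add_sqrt {a b : ℝ} (ha : 0 ≤ a) (hb : 0 ≤ b) :
    Real.sqrt (a + b) ≤ Real.sqrt a + Real.sqrt b := by
  refine Real.sqrt_le_iff.2 ⟨by positivity, ?_⟩
  have h : 0 ≤ Real.sqrt a * Real.sqrt b := by positivity
  nlinarith [Real.sq_sqrt ha, Real.sq_sqrt hb]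

/-- A bound linear in k makes the weighted dyadic sum explicit: ∑ (3+k)/2^{k+1} = 4. The lower bound
on t keeps the coefficient of k positive after squaring. -/
theorem sqrt_two_mul_add_le {t : ℝ} (ht : 3 / 8 ≤ t) (k : ℕ) :
    Real.sqrt (2 * (t + k + 1)) ≤ Real.sqrt (1 + t) * ((3 + k) / 2) := by
  refine Real.sqrt_le_iff.2 ⟨by positivity, ?_⟩
  rw [mul_pow, Real.sq_sqrt (by linarith)]
  have hk : (0 : ℝ) ≤ k := k.cast_nonneg
  nlinarith [mul_nonneg hk hk, mul_nonneg hk (by linarith : (0 : ℝ) ≤ t - 3 / 8),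
    mul_nonneg (mul_nonneg hk hk) (by linarith : (0 : ℝ) ≤ t)]

theorem sum_dyadic_sqrt_le {t : ℝ} (ht : 3 / 8 ≤ t) {R : ℝ} (hR : 0 < R) (K : ℕ) :
    ∑ k ∈ Finset.range K, R / 2 ^ k * Real.sqrt (2 * (t + k + 1)) ≤ 4 * R * Real.sqrt (1 + t) := by
  -- The exact partial sums of (3+k)/2^{k+1} are 4 - (K+4)/2^K, which makes the induction close.
  have h : ∀ K : ℕ, ∑ k ∈ Finset.range K, R / 2 ^ k * Real.sqrt (2 * (t + k + 1))
      ≤ R * Real.sqrt (1 + t) * (4 - (K + 4) / 2 ^ K) := by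
    intro K
    induction K with
    | zero => simp
    | succ K ih =>
      rw [Finset.sum_range_succ]
      calc _ ≤ R * Real.sqrt (1 + t) * (4 - (K + 4) / 2 ^ K)
            + R / 2 ^ K * (Real.sqrt (1 + t) * ((3 + K) / 2)) := by
              gcongr
              exact sqrt_two_mul_add_le ht K
        _ = _ := by
              push_cast
              rw [pow_succ]
              field_simp
              ring
  refine (h K).trans ?_
  have h1 : 0 ≤ R * Real.sqrt (1 + t) := by positivity
  have h2 : (0 : ℝ) ≤ (K + 4) / 2 ^ K := by positivity
  nlinarith

end LeastSquares

/-! ### Geometric union bound and real-valued entropy sums -/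

namespace LeastSquares

theorem measure_iUnion_le_exp_neg {Ω : Type*} [MeasurableSpace Ω] {P : Measure Ω} {A : ℕ → Set Ω}
    {t : ℝ} (hA : ∀ k : ℕ, P (A k) ≤ ENNReal.ofReal (Real.exp (-(t + (k + 1))))) :
    P (⋃ k, A k) ≤ ENNReal.ofReal (Real.exp (-t)) := by
  have hk : ∀ k : ℕ, P (A k) ≤ ENNReal.ofReal (Real.exp (-t)) * 2⁻¹ ^ (k + 1) := by
    intro k
    have h2 : (2⁻¹ : ℝ≥0∞) ^ (k + 1) = ENNReal.ofReal ((2⁻¹ : ℝ) ^ (k + 1)) := by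
      rw [ENNReal.ofReal_pow (by norm_num), ENNReal.ofReal_inv_of_pos (by norm_num)]
      simp
    refine (hA k).trans ?_
    rw [h2, ← ENNReal.ofReal_mul (Real.exp_nonneg _)]
    refine ENNReal.ofReal_le_ofReal ?_
    -- Replacing 1/e by 1/2 loses nothing that matters: ∑ 2^{-(k+1)} is exactly 1.
    have h3 : Real.exp (-1) ≤ 2⁻¹ := by
      rw [Real.exp_neg]
      exact inv_anti₀ (by norm_num) (by linarith [Real.add_one_le_exp 1])
    rw [neg_add, Real.exp_add,
      show -((k : ℝ) + 1) = ((k + 1 : ℕ) : ℝ) * (-1) by push_cast; ring, Real.exp_nat_mul]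
    gcongr
  calc P (⋃ k, A k) ≤ ∑' k, P (A k) := measure_iUnion_le _
    _ ≤ ∑' k : ℕ, ENNReal.ofReal (Real.exp (-t)) * 2⁻¹ ^ (k + 1) := ENNReal.tsum_le_tsum hk
    _ = ENNReal.ofReal (Real.exp (-t)) := by
      rw [ENNReal.tsum_mul_left, ENNReal.tsum_geometric_add_one, ENNReal.one_sub_inv_two, inv_inv,
        ENNReal.inv_mul_cancel (by norm_num) (by norm_num), mul_one]

section EntropyReal

variable {n : ℕ} {X Y : Type*} [NormedAddCommGroup Y]

/-- An infinite entropy would enter the dyadic sum with positive weight and force the integral to be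
infinite. -/
theorem entropy_dyadic_ne_top (x : Fin n → X) {F : Set (X → Y)} {R : ℝ} (hR : 0 < R)
    (hJ : entropyIntegral x F R ≠ ∞) (k : ℕ) :
    entropy x (R / 2 ^ (k + 1)) (localClass x F R) ≠ ∞ := by
  intro h
  have h1 := sum_dyadic_entropy_le_entropyIntegral x F hR (k + 1)
  rw [Finset.sum_range_succ, h] at h1
  refine hJ (top_unique (le_trans ?_ h1))
  have hpos : ENNReal.ofReal (R / 2 ^ k) ≠ 0 := by
    rw [Ne, ENNReal.ofReal_eq_zero, not_le]
    positivity
  rw [ENNReal.mul_top (by norm_num), ENNReal.top_rpow_of_pos (by norm_num), ENNReal.mul_top hpos]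
  exact le_add_self

theorem sum_dyadic_sqrt_entropy_le (x : Fin n → X) {F : Set (X → Y)} {R : ℝ} (hR : 0 < R)
    (hJ : entropyIntegral x F R ≠ ∞) (K : ℕ) :
    ∑ k ∈ Finset.range K, R / 2 ^ k *
        Real.sqrt (2 * (entropy x (R / 2 ^ (k + 1)) (localClass x F R)).toReal)
      ≤ (entropyIntegral x F R).toReal := by
  have h1 := ENNReal.toReal_mono hJ (sum_dyadic_entropy_le_entropyIntegral x F hR K)
  rw [ENNReal.toReal_sum fun k _ => ENNReal.mul_ne_top ENNReal.ofReal_ne_top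
    (ENNReal.rpow_ne_top_of_nonneg (by norm_num)
      (ENNReal.mul_ne_top (by norm_num) (entropy_dyadic_ne_top x hR hJ k)))] at h1
  refine le_trans (le_of_eq (Finset.sum_congr rfl fun k _ => ?_)) h1
  rw [ENNReal.toReal_mul, ENNReal.toReal_ofReal (by positivity), ← ENNReal.toReal_rpow,
    ENNReal.toReal_mul, Real.sqrt_eq_rpow]
  simp

end EntropyReal

/-! ### Maximal inequality by chaining -/

section Maximal

variable {Ω : Type*} [MeasurableSpace Ω] {P : Measure Ω} [IsProbabilityMeasure P]
  {X Y : Type*} [NormedAddCommGroup Y] [InnerProductSpace ℝ Y] [CompleteSpace Y]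
  [TopologicalSpace.SeparableSpace Y] [MeasurableSpace Y] [BorelSpace Y]
  {μ : Measure Y}

/-- The maximal inequality for the Gaussian noise process over a local class. -/
theorem exists_noiseProcess_le [IsGaussian μ] (hmean : ∫ y, y ∂μ = 0)
    (htrace : HasTrace (covarianceOperator μ) 1) {n : ℕ} {ε : Fin n → Ω → Y}
    (hlaw : ∀ i, HasLaw (ε i) μ P) (hindep : iIndepFun ε P) (x : Fin n → X) {F : Set (X → Y)}
    (hF0 : (0 : X → Y) ∈ F) {R : ℝ} (hR : 0 < R) (hJ : entropyIntegral x F R ≠ ∞) {t : ℝ}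
    (ht : 3 / 8 ≤ t) :
    ∃ A : Set Ω, P A ≤ ENNReal.ofReal (Real.exp (-t)) ∧ ∀ ω ∉ A, ∀ h ∈ localClass x F R,
      noiseProcess x (fun i => ε i ω) h
        ≤ (entropyIntegral x F R).toReal + 4 * R * Real.sqrt (1 + t) := by
  classical
  set B := localClass x F R with hBdef
  have h0B : (0 : X → Y) ∈ B := ⟨hF0, by simpa [empNorm] using hR.le⟩
  set H : ℕ → ℝ := fun k => (entropy x (R / 2 ^ k) B).toReal with hHdef
  have hH0 : ∀ k, 0 ≤ H k := fun k => ENNReal.toReal_nonneg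
  have hcov : ∀ k : ℕ, ∃ D : Finset (X → Y), ↑D ⊆ B ∧
      (∀ h ∈ B, ∃ p ∈ D, empNorm x (h - p) ≤ R / 2 ^ k) ∧ (D.card : ℝ) ≤ Real.exp (H k) ∧
      (k = 0 → D = {0}) := by
    rintro (_ | k)
    -- At radius R the single centre 0 covers the class, so every chain starts where the noise
    -- process vanishes.
    · refine ⟨{0}, by simpa using h0B, fun h hh => ⟨0, by simp, by simpa using hh.2⟩, ?_,
        fun _ => rfl⟩
      simpa using hH0 0
    · obtain ⟨D, h1, h2, h3⟩ := exists_finset_cover x ⟨0, h0B⟩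
        (show 0 ≤ R / 2 ^ (k + 1) by positivity) (entropy_dyadic_ne_top x hR hJ k)
      exact ⟨D, h1, h2, h3.le, by simp⟩
  choose D hDB hDcov hDcard hD0 using hcov
  choose! π hπD hπ using hDcov
  -- Chosen so that a link of length at most R/2^k has tail exp(-(H(k+1) + t + k + 1)): the entropy
  -- pays for the union over the at most exp(H(k+1)) points of level k + 1, and k + 1 for the sum
  -- over levels.
  set a : ℕ → ℝ := fun k => R / 2 ^ k * Real.sqrt (2 * (H (k + 1) + (t + (k + 1)))) with ha
  set A : ℕ → Set Ω := fun k => ⋃ p ∈ D (k + 1),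
    {ω | a k ≤ noiseProcess x (fun i => ε i ω) (p - π k p)} with hA
  have ha_sum : ∀ K : ℕ, ∑ k ∈ Finset.range K, a k
      ≤ (entropyIntegral x F R).toReal + 4 * R * Real.sqrt (1 + t) := by
    intro K
    refine le_trans ?_ (add_le_add (sum_dyadic_sqrt_entropy_le x hR hJ K)
      (sum_dyadic_sqrt_le ht hR K))
    rw [← Finset.sum_add_distrib]
    refine Finset.sum_le_sum fun k _ => ?_
    rw [← mul_add]
    refine mul_le_mul_of_nonneg_left ?_ (by positivity)
    rw [mul_add, add_assoc t]
    exact sqrt_add_le_add_sqrt (by have := hH0 (k + 1); positivity) (by positivity)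
  refine ⟨⋃ k, A k, measure_iUnion_le_exp_neg fun k => ?_, fun ω hω h hh => ?_⟩
  · have hr : 0 < R / 2 ^ k := by positivity
    calc P (A k)
        ≤ ∑ p ∈ D (k + 1), P {ω | a k ≤ noiseProcess x (fun i => ε i ω) (p - π k p)} :=
          measure_biUnion_finset_le _ _
      _ ≤ ∑ p ∈ D (k + 1), ENNReal.ofReal (Real.exp (-(H (k + 1) + (t + (k + 1))))) := by
          refine Finset.sum_le_sum fun p hp => ?_
          refine (measure_le_noiseProcess_le hmean htrace hlaw hindep x (hπ k p (hDB _ hp))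
            (by positivity)).trans_eq ?_
          congr 2
          have h1 : 0 ≤ 2 * (H (k + 1) + (t + (k + 1))) := by
            have := hH0 (k + 1)
            positivity
          rw [ha, mul_pow, Real.sq_sqrt h1]
          field_simp
      _ = ENNReal.ofReal ((D (k + 1)).card * Real.exp (-(H (k + 1) + (t + (k + 1))))) := by
          rw [Finset.sum_const, nsmul_eq_mul, ENNReal.ofReal_mul (Nat.cast_nonneg _),
            ENNReal.ofReal_natCast]
      _ ≤ ENNReal.ofReal (Real.exp (-(t + (k + 1)))) := by
          refine ENNReal.ofReal_le_ofReal ?_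
          calc _ ≤ Real.exp (H (k + 1)) * Real.exp (-(H (k + 1) + (t + (k + 1)))) := by
                gcongr
                exact hDcard _
            _ = _ := by
                rw [← Real.exp_add]
                congr 1
                ring
  · set W := noiseProcess x fun i => ε i ω with hW
    have hgood : ∀ k : ℕ, ∀ p ∈ D (k + 1), W (p - π k p) ≤ a k := by
      intro k p hp
      by_contra! hlt
      exact hω (Set.mem_iUnion.2 ⟨k, Set.mem_iUnion₂.2 ⟨p, hp, hlt.le⟩⟩)
    -- Each point is projected to the preceding level only, so the number of links at level k + 1 is
    -- the number of its points, not of pairs.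
    have hchain : ∀ K : ℕ, ∀ p ∈ D K, W p ≤ ∑ k ∈ Finset.range K, a k := by
      intro K
      induction K with
      | zero =>
        intro p hp
        rw [hD0 0 rfl, Finset.mem_singleton] at hp
        simp [hp, hW, noiseProcess_zero]
      | succ K ih =>
        intro p hp
        have h1 := hgood K p hp
        have h2 := ih _ (hπD K p (hDB _ hp))
        rw [hW, noiseProcess_sub, ← hW] at h1
        rw [Finset.sum_range_succ]
        linarith
    set S := Real.sqrt (∑ i, ‖ε i ω‖ ^ 2) with hS
    have hbound : ∀ K : ℕ, W h ≤ (entropyIntegral x F R).toReal + 4 * R * Real.sqrt (1 + t)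
        + S * (R / 2 ^ K) := by
      intro K
      have h1 := (hchain K _ (hπD K h hh)).trans (ha_sum K)
      have h2 := (noiseProcess_le x (fun i => ε i ω) (h - π K h)).trans
        (mul_le_mul_of_nonneg_left (hπ K h hh) (Real.sqrt_nonneg _))
      rw [noiseProcess_sub, ← hW, ← hS] at h2
      linarith
    -- With ω fixed, S is a finite constant and the remainder tends to 0; neither separability nor
    -- continuity of the process is invoked.
    refine ge_of_tendsto' (x := Filter.atTop) ?_ hbound
    have hlim : Filter.Tendsto (fun K : ℕ => R / 2 ^ K) Filter.atTop (nhds 0) := by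
      simpa [div_eq_mul_inv] using
        (tendsto_pow_atTop_nhds_zero_of_lt_one (r := (2⁻¹ : ℝ)) (by norm_num)
          (by norm_num)).const_mul R
    simpa using (hlim.const_mul S).const_add
      ((entropyIntegral x F R).toReal + 4 * R * Real.sqrt (1 + t))

end Maximal

/-! ### Scaling of the critical inequality -/

/-- The critical inequality at `δ` propagates to the larger radii `2 ^ (s + 1) * δ`. -/
theorem critical_inequality_dyadic {J : ℝ → ℝ}
    (hJ : AntitoneOn (fun δ : ℝ => J δ / δ ^ 2) (Set.Ioi 0)) {t δ c : ℝ} (ht : 0 < t) (hδ : 0 < δ)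
    (h : 8 * (J δ + 4 * δ * Real.sqrt (1 + t) + δ * Real.sqrt (8 / 3 * t)) ≤ c * δ ^ 2) (s : ℕ) :
    J (2 ^ (s + 1) * δ) + 4 * (2 ^ (s + 1) * δ) * Real.sqrt (1 + 4 ^ (s + 1) * t)
      < c * (2 ^ (s + 1) * δ) ^ 2 / 8 := by
  set m : ℝ := 2 ^ (s + 1) with hm
  have hm1 : 1 ≤ m := one_le_pow₀ (by norm_num)
  have hm2 : (4 : ℝ) ^ (s + 1) = m ^ 2 := by
    rw [hm, ← pow_mul, mul_comm, pow_mul]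
    norm_num
  have hJm : J (m * δ) ≤ m ^ 2 * J δ := by
    have h1 : J (m * δ) / (m * δ) ^ 2 ≤ J δ / δ ^ 2 :=
      hJ (Set.mem_Ioi.2 hδ) (Set.mem_Ioi.2 (by positivity)) (by nlinarith)
    rw [div_le_iff₀ (by positivity)] at h1
    refine h1.trans_eq ?_
    field_simp
  have hsqrt : Real.sqrt (1 + m ^ 2 * t) ≤ m * Real.sqrt (1 + t) := by
    refine Real.sqrt_le_iff.2 ⟨by positivity, ?_⟩
    rw [mul_pow, Real.sq_sqrt (by positivity)]
    nlinarith
  -- This term supplies the strict inequality.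
  have hpos : 0 < Real.sqrt (8 / 3 * t) := Real.sqrt_pos.2 (by positivity)
  rw [hm2]
  calc J (m * δ) + 4 * (m * δ) * Real.sqrt (1 + m ^ 2 * t)
      ≤ m ^ 2 * J δ + 4 * (m * δ) * (m * Real.sqrt (1 + t)) := by gcongr
    _ < m ^ 2 * (J δ + 4 * δ * Real.sqrt (1 + t) + δ * Real.sqrt (8 / 3 * t)) := by
        have : 0 < m ^ 2 * (δ * Real.sqrt (8 / 3 * t)) := by positivity
        linarith
    _ ≤ m ^ 2 * (c * δ ^ 2 / 8) := by
        gcongr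
        linarith
    _ = c * (m * δ) ^ 2 / 8 := by ring

/-- Bernoulli gives 4^{s+1} ≥ 1 + 3(s+1), and 3t ≥ 1. It makes the shell probabilities summable to
e^{-t}. -/
theorem add_succ_le_four_pow_mul {t : ℝ} (ht : 3 / 8 ≤ t) (s : ℕ) :
    t + (s + 1) ≤ 4 ^ (s + 1) * t := by
  have h := one_add_mul_le_pow (show (-2 : ℝ) ≤ 3 by norm_num) (s + 1)
  norm_num at h
  have hs : (0 : ℝ) ≤ s := s.cast_nonneg
  nlinarith [mul_le_mul_of_nonneg_right h (by linarith : 0 ≤ t)]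

end LeastSquares

/-! ### Peeling -/

theorem mainTheorem8
    {Ω : Type*} [MeasurableSpace Ω] (P : Measure Ω) [IsProbabilityMeasure P]
    {X : Type*}
    {Y : Type*} [NormedAddCommGroup Y] [InnerProductSpace ℝ Y] [CompleteSpace Y]
    [TopologicalSpace.SeparableSpace Y] [MeasurableSpace Y] [BorelSpace Y]
    -- the sample size, the fixed design, the class of functions and the regression function
    (n : ℕ) (x : Fin n → X) (G : Set (X → Y)) (g₀ : X → Y) (hg₀ : g₀ ∈ G)
    -- i.i.d. Gaussian noise with mean zero and a covariance operator of trace one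
    (ε : Fin n → Ω → Y) (μ : Measure Y) (hμ : IsGaussian μ) (hμ_mean : ∫ y, y ∂μ = 0)
    (hμ_trace : LeastSquares.HasTrace (covarianceOperator μ) 1)
    (hε_law : ∀ i, HasLaw (ε i) μ P) (hε_indep : iIndepFun ε P)
    -- the observations and the least-squares estimator
    (Yobs : Fin n → Ω → Y) (hYobs : ∀ i ω, Yobs i ω = g₀ (x i) + ε i ω)
    (ghat : Ω → X → Y)
    (hghat : ∀ᵐ ω ∂P, LeastSquares.IsLeastSquaresFit x G (fun i => Yobs i ω) (ghat ω))
    -- a class that contains the differences `g - g₀`, for instance `{g - g₀ : g ∈ G}` itself,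
    -- or `G` if `G` is closed under subtraction of `g₀`
    (F : Set (X → Y)) (hF : ∀ g ∈ G, g - g₀ ∈ F)
    -- `J` is finite and `J(δ)/δ²` is decreasing
    (hJ_fin : ∀ δ : ℝ, 0 < δ → LeastSquares.entropyIntegral x F δ < ∞)
    (hJ_anti : AntitoneOn (fun δ : ℝ => (LeastSquares.entropyIntegral x F δ).toReal / δ ^ 2)
      (Set.Ioi 0)) :
    ∀ t : ℝ, 3 / 8 ≤ t → ∀ δ : ℝ, 0 < δ →
      8 * ((LeastSquares.entropyIntegral x F δ).toReal + 4 * δ * Real.sqrt (1 + t)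
          + δ * Real.sqrt (8 / 3 * t)) ≤ Real.sqrt n * δ ^ 2 →
      P {ω | δ < LeastSquares.empNorm x (ghat ω - g₀)}
        ≤ ENNReal.ofReal ((1 + 2 / (Real.exp 1 - 1)) * Real.exp (-t)) := by
  intro t ht δ hδ hcrit
  have hF0 : (0 : X → Y) ∈ F := by simpa using hF g₀ hg₀
  have hRpos : ∀ s : ℕ, 0 < 2 ^ (s + 1) * δ := fun s => by positivity
  -- Scaling t by the square of the radius factor makes R√(1+t) grow at most quadratically, like the
  -- bound on J(R).
  have hts : ∀ s : ℕ, 3 / 8 ≤ 4 ^ (s + 1) * t := fun s => by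
    have h1 := LeastSquares.add_succ_le_four_pow_mul ht s
    have h2 : (0 : ℝ) ≤ s := s.cast_nonneg
    linarith
  choose A hA hW using fun s : ℕ => LeastSquares.exists_noiseProcess_le hμ_mean hμ_trace hε_law
    hε_indep x hF0 (hRpos s) (hJ_fin _ (hRpos s)).ne (hts s)
  have hsub : ∀ᵐ ω ∂P, ω ∈ {ω | δ < LeastSquares.empNorm x (ghat ω - g₀)} → ω ∈ ⋃ s, A s := by
    filter_upwards [hghat] with ω hω hlt
    have hlt' : δ < LeastSquares.empNorm x (ghat ω - g₀) := hlt
    obtain ⟨s, hs1, hs2⟩ := exists_nat_pow_near ((one_le_div hδ).2 hlt'.le) one_lt_two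
    rw [le_div_iff₀ hδ] at hs1
    rw [div_lt_iff₀ hδ] at hs2
    by_contra hnot
    have h1 := hW s ω (fun h => hnot (Set.mem_iUnion.2 ⟨s, h⟩)) (ghat ω - g₀)
      ⟨hF _ hω.1, hs2.le⟩
    have h2 := hω.sqrt_mul_empNorm_sq_le hg₀ fun i => hYobs i ω
    have h3 := LeastSquares.critical_inequality_dyadic hJ_anti (by linarith) hδ hcrit s
    have h4 : Real.sqrt n * (2 ^ s * δ) ^ 2
        ≤ Real.sqrt n * LeastSquares.empNorm x (ghat ω - g₀) ^ 2 := by gcongr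
    -- The 8 is 4 · 2: the squared ratio of the shell's radii times the 2 of the basic inequality.
    have h5 : Real.sqrt n * (2 ^ (s + 1) * δ) ^ 2 / 8 = Real.sqrt n * (2 ^ s * δ) ^ 2 / 2 := by
      rw [pow_succ]
      ring
    linarith
  refine (measure_mono_ae hsub).trans ((LeastSquares.measure_iUnion_le_exp_neg (t := t)
    fun s => (hA s).trans ?_).trans ?_)
  · refine ENNReal.ofReal_le_ofReal (Real.exp_le_exp.2 (neg_le_neg ?_))
    exact LeastSquares.add_succ_le_four_pow_mul ht s
  -- The argument already gives e^{-t}; the stated constant exceeds 1.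
  · refine ENNReal.ofReal_le_ofReal (le_mul_of_one_le_left (Real.exp_nonneg _) ?_)
    have h1 : 0 < Real.exp 1 - 1 := by linarith [Real.add_one_le_exp 1]
    have h2 : 0 < 2 / (Real.exp 1 - 1) := by positivity
    linarith
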